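/- Let $d\ge 1$, let $\mathbb M_d$ be the algebra of complex $d\times d$ matrices and let $\|X\|_1=\operatorname{tr}\sqrt{X^*X}$ be the trace norm. For a positive trace-preserving linear map $T:\mathbb M_d\to\mathbb M_d$ put $$\kappa_{\rm tr}(T)=\sup\Big\{\frac{\|T(X)\|_1}{\|X\|_1}:\ X=X^*,\ \operatorname{tr}X=0,\ X\neq0\Big\}\in[0,1]$$ (the supremum of the empty set, which occurs only for $d=1$, is $0$). Let $(\Omega,\mathcal F,\mathbb P,\theta)$ be an invertible probability-preserving system with $\theta$ ergodic, and let $\omega\mapsto\Phi_\omega$ be a measurable family of completely positive trace-preserving linear maps on $\mathbb M_d$. For $n\ge1$ set $$\Phi_{\omega;n:0}=\Phi_{\theta^{n-1}\omega}\circ\cdots\circ\Phi_{\theta\omega}\circ\Phi_\omega,\qquad \kappa_{\omega;n:0}=\kappa_{\rm tr}(\Phi_{\omega;n:0}),$$ and use the convention $\log 0=-\infty$. Then there is a constant $\lambda_{\rm tr}\in[-\infty,0]$, the trace-Dobrushin Lyapunov exponent, such that $$\lambda_{\rm tr}=\lim_{n\to\infty}\frac1n\log\kappa_{\omega;n:0}\qquad\text{for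 }\mathbb P\text{-almost every }\omega,$$ and the following equivalences hold. 1. $\lambda_{\rm tr}<0$ if and only if there exists $L\ge1$ such that $\mathbb P\{\omega:\kappa_{\omega;L:0}<1\}>0$. 2. $\lambda_{\rm tr}<0$ if and only if there exists $L\ge1$ such that $\mathbb E[\log\kappa_{\omega;L:0}]<0$, where for a random variable $F$ with values in $[-\infty,0]$ one sets $\mathbb E[F]=-\mathbb E[-F]\in[-\infty,0]$. -/

import Mathlib

open MeasureTheory Filter Topology
open scoped ENNReal

namespace TraceDobrushin

/-- The algebra `𝕄_d` of complex `d × d` matrices. -/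
abbrev Mat (d : ℕ) : Type := Matrix (Fin d) (Fin d) ℂ

section CompletePositivity

open scoped CStarAlgebra ComplexOrder MatrixOrder Matrix.Norms.L2Operator

/-- A linear map on `𝕄_d` is a quantum channel (CPTP) if it is completely positive and trace
preserving. Here `𝕄_d` carries its C⋆-norm and the usual (Loewner) order. -/
def IsCPTP {d : ℕ} (T : Mat d →ₗ[ℂ] Mat d) : Prop :=
  (∃ φ : Mat d →CP Mat d, φ.toLinearMap = T) ∧ ∀ X : Mat d, (T X).trace = X.trace

end CompletePositivity

/-- The trace norm `‖X‖₁ = tr √(X* X)`, that is, the sum of the singular values of `X`. -/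
noncomputable def traceNorm {d : ℕ} (X : Mat d) : ℝ :=
  ∑ i, √((Matrix.isHermitian_conjTranspose_mul_self X).eigenvalues i)

/-- The centered trace-Dobrushin coefficient: the supremum of `‖T X‖₁ / ‖X‖₁` over nonzero
self-adjoint trace-zero `X`. It is taken in `[0, ∞]`, where every supremum exists, and it lies
in `[0, 1]` for positive trace-preserving `T`. -/
noncomputable def kappaTr {d : ℕ} (T : Mat d →ₗ[ℂ] Mat d) : ℝ≥0∞ :=
  ⨆ X ∈ {X : Mat d | X.IsHermitian ∧ X.trace = 0 ∧ X ≠ 0},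
    ENNReal.ofReal (traceNorm (T X) / traceNorm X)

/-- The forward product `Φ_{ω;n:0} = Φ_{θ^{n-1} ω} ∘ ⋯ ∘ Φ_{θ ω} ∘ Φ_ω`, with `Φ_{ω;0:0} = id`. -/
def forwardProduct {d : ℕ} {Ω : Type*} (θ : Ω → Ω) (Φ : Ω → Mat d →ₗ[ℂ] Mat d) :
    ℕ → Ω → Mat d →ₗ[ℂ] Mat d
  | 0, _ => LinearMap.id
  | n + 1, ω => Φ (θ^[n] ω) ∘ₗ forwardProduct θ Φ n ω

/-- `κ_{ω;n:0}`, the coefficient of the forward product of length `n`. -/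
noncomputable def blockKappa {d : ℕ} {Ω : Type*} (θ : Ω → Ω) (Φ : Ω → Mat d →ₗ[ℂ] Mat d)
    (n : ℕ) (ω : Ω) : ℝ≥0∞ :=
  kappaTr (forwardProduct θ Φ n ω)

/-- `log κ_{ω;n:0}` in `[-∞, 0]`, with `log 0 = -∞`. -/
noncomputable def logKappa {d : ℕ} {Ω : Type*} (θ : Ω → Ω) (Φ : Ω → Mat d →ₗ[ℂ] Mat d)
    (n : ℕ) (ω : Ω) : EReal :=
  ENNReal.log (blockKappa θ Φ n ω)

/-- The constant `l` is the trace-Dobrushin Lyapunov exponent: `(1/n) log κ_{ω;n:0}` converges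
to `l` in the extended reals for almost every `ω`. -/
def IsLyapunovExponent {d : ℕ} {Ω : Type*} [MeasurableSpace Ω] (P : Measure Ω) (θ : Ω → Ω)
    (Φ : Ω → Mat d →ₗ[ℂ] Mat d) (l : EReal) : Prop :=
  ∀ᵐ ω ∂P, Tendsto (fun n : ℕ => logKappa θ Φ n ω / (n : EReal)) atTop (𝓝 l)

/-- The expectation `E[F] = -E[-F] ∈ [-∞, 0]` of a nonpositive extended random variable. -/
noncomputable def nonposExpectation {Ω : Type*} [MeasurableSpace Ω] (P : Measure Ω)
    (F : Ω → EReal) : EReal :=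
  -((∫⁻ ω, (-F ω).toENNReal ∂P : ℝ≥0∞) : EReal)

end TraceDobrushin

open TraceDobrushin

/-! The coefficient is submultiplicative and at most 1 on positive trace-preserving maps, so `g n =
-log κ_n` is a superadditive process with values in `[0, ∞]`. The limit of `g n / n` is the supremum
`c` of the finite rates `a` for which `g n - a n` is unbounded above with positive probability;
ergodicity makes this a zero-one event. Above `c` the bound is immediate. Below `c`, a rate `a` is
reached within `M` steps off a set `B` of small measure, and a greedy splitting of the orbit
(`mul_le_add_visits`) loses only `a` per visit to `B`. Visits are counted by `ae_visits_lt`, the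
same argument applied to the visit process itself, so neither Birkhoff's theorem nor integrability
of `g` enters. The splitting also gives the criterion: if `g L ≥ δ > 0` with positive probability,
the complement is visited with frequency below 1, so `c > 0`. -/

namespace SuperadditiveProcess

open scoped NNReal

/-! ### Pathwise estimates for superadditive processes -/

variable {Ω : Type*} {θ : Ω → Ω} {g : ℕ → Ω → ℝ≥0∞}

/-- A superadditive process with values in `[0, ∞]` over the map `θ`. -/
def IsSuperadditive (θ : Ω → Ω) (g : ℕ → Ω → ℝ≥0∞) : Prop :=
  ∀ m n ω, g m ω + g n (θ^[m] ω) ≤ g (m + n) ω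

/-- The number of visits of the orbit of `ω` to `B` before time `n`. -/
noncomputable def visits (θ : Ω → Ω) (B : Set Ω) (n : ℕ) (ω : Ω) : ℝ≥0∞ :=
  birkhoffSum θ (B.indicator 1) n ω

lemma visits_add (B : Set Ω) (m n : ℕ) (ω : Ω) :
    visits θ B (m + n) ω = visits θ B m ω + visits θ B n (θ^[m] ω) :=
  birkhoffSum_add θ _ m n ω

lemma visits_one (B : Set Ω) (ω : Ω) : visits θ B 1 ω = B.indicator 1 ω :=
  birkhoffSum_one θ _ ω

lemma isSuperadditive_visits (B : Set Ω) : IsSuperadditive θ (visits θ B) :=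
  fun m n ω => (visits_add B m n ω).ge

/-- Greedy decomposition of the orbit: off `B` one gains at rate `a` within at most `M` steps. -/
lemma mul_le_add_visits (hg : IsSuperadditive θ g) {a : ℝ≥0∞} {M : ℕ} {B : Set Ω}
    (hB : ∀ ω ∉ B, ∃ n, 1 ≤ n ∧ n ≤ M ∧ a * n ≤ g n ω) (N : ℕ) (ω : Ω) :
    a * N ≤ g N ω + a * M + a * visits θ B N ω := by
  induction N using Nat.strong_induction_on generalizing ω with
  | _ N ih =>
    -- A final stretch too short to hold a full block is paid for by `a * M`.
    by_cases hN : N ≤ M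
    · calc a * N ≤ a * M := by gcongr
        _ ≤ _ := le_add_right le_add_self
    have step : ∀ n k : ℕ, 1 ≤ n → N = n + k → a * n ≤ g n ω + a * visits θ B n ω →
        a * N ≤ g N ω + a * M + a * visits θ B N ω := by
      rintro n k hn rfl h
      have hk := ih k (by omega) (θ^[n] ω)
      calc a * ((n + k : ℕ) : ℝ≥0∞) = a * n + a * k := by push_cast; ring
        _ ≤ (g n ω + a * visits θ B n ω) +
            (g k (θ^[n] ω) + a * M + a * visits θ B k (θ^[n] ω)) := by gcongr
        _ = (g n ω + g k (θ^[n] ω)) + a * M + a * visits θ B (n + k) ω := by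
          rw [visits_add]; ring
        _ ≤ _ := by gcongr; exact hg n k ω
    by_cases hω : ω ∈ B
    · refine step 1 (N - 1) le_rfl (by omega) ?_
      rw [visits_one, Set.indicator_of_mem hω]
      simp
    · obtain ⟨n, hn, hnM, h⟩ := hB ω hω
      exact step n (N - n) hn (by omega) (h.trans le_self_add)

/-- The set where `g n - a n` is unbounded above. -/
def excessSet (g : ℕ → Ω → ℝ≥0∞) (a : ℝ≥0∞) : Set Ω :=
  {ω | ∀ C : ℕ, ∃ n : ℕ, 1 ≤ n ∧ a * n + C ≤ g n ω}

/-- Prepending one step cannot lower the gain, and its extra cost `a` is absorbed into the arbitrary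
constant; this needs `a` finite. -/
lemma preimage_excessSet_subset (hg : IsSuperadditive θ g) (a : ℝ≥0) :
    θ ⁻¹' excessSet g a ⊆ excessSet g a := by
  intro ω hω C
  obtain ⟨D, hD⟩ := exists_nat_ge (a : ℝ≥0)
  obtain ⟨n, hn, h⟩ := hω (C + D)
  refine ⟨1 + n, by omega, ?_⟩
  have hD' : (a : ℝ≥0∞) ≤ D := by exact_mod_cast hD
  calc (a : ℝ≥0∞) * ((1 + n : ℕ) : ℝ≥0∞) + C = a * n + (C + a) := by push_cast; ring
    _ ≤ a * n + ((C + D : ℕ) : ℝ≥0∞) := by push_cast; gcongr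
    _ ≤ g n (θ ω) := h
    _ ≤ g (1 + n) ω := le_trans le_add_self (hg 1 n ω)

/-- A linear lower bound with a rate defect yields a strict lower bound for the averages. -/
lemma eventually_lt_div {a t b K : ℝ≥0} {x : ℕ → ℝ≥0∞}
    (h : ∀ N : ℕ, (a : ℝ≥0∞) * N ≤ x N + K + a * (t * N)) (hb : b + a * t < a) :
    ∀ᶠ N : ℕ in atTop, (b : ℝ≥0∞) < x N / N := by
  have hb' : (0 : ℝ) < a - a * t - b := by
    have : (b : ℝ) + a * t < a := by exact_mod_cast hb
    linarith
  obtain ⟨N₀, hN₀⟩ := exists_nat_gt ((K : ℝ) / (a - a * t - b))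
  filter_upwards [eventually_ge_atTop (N₀ + 1)] with N hN
  have hNpos : (0 : ℝ) < N := by exact_mod_cast (by omega : 0 < N)
  rw [ENNReal.lt_div_iff_mul_lt (Or.inl (by exact_mod_cast (by omega : N ≠ 0)))
    (Or.inl (ENNReal.natCast_ne_top N))]
  by_contra! hx
  have h1 : (a : ℝ≥0∞) * N ≤ b * N + K + a * (t * N) := (h N).trans (by gcongr)
  have h2 : (a : ℝ) * N ≤ b * N + K + a * (t * N) := by exact_mod_cast h1
  have h3 : (K : ℝ) < N * (a - a * t - b) := by
    rw [div_lt_iff₀ hb'] at hN₀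
    have : (N₀ : ℝ) ≤ N := by exact_mod_cast (by omega : N₀ ≤ N)
    nlinarith
  nlinarith

lemma eventually_div_lt {a b : ℝ≥0} {C : ℕ} {x : ℕ → ℝ≥0∞}
    (h : ∀ N : ℕ, 1 ≤ N → x N < a * N + C) (hb : a < b) :
    ∀ᶠ N : ℕ in atTop, x N / N < b := by
  have hb' : (0 : ℝ) < b - a := by
    have : (a : ℝ) < b := by exact_mod_cast hb
    linarith
  obtain ⟨N₀, hN₀⟩ := exists_nat_gt ((C : ℝ) / (b - a))
  filter_upwards [eventually_ge_atTop (N₀ + 1)] with N hN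
  rw [ENNReal.div_lt_iff (Or.inl (by exact_mod_cast (by omega : N ≠ 0)))
    (Or.inl (ENNReal.natCast_ne_top N))]
  refine (h N (by omega)).trans_le ?_
  rw [div_lt_iff₀ hb'] at hN₀
  have hN' : (N₀ : ℝ) ≤ N := by exact_mod_cast (by omega : N₀ ≤ N)
  have : (a : ℝ) * N + C ≤ b * N := by nlinarith
  exact_mod_cast this

/-! ### Almost sure limits over an ergodic map -/

section Measure

variable [MeasurableSpace Ω] {P : Measure Ω}

lemma measurableSet_excessSet (hm : ∀ n, Measurable (g n)) (a : ℝ≥0∞) :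
    MeasurableSet (excessSet g a) := by
  simp only [excessSet, Set.ofPred_forall, Set.ofPred_exists, Set.ofPred_and]
  refine MeasurableSet.iInter fun C => MeasurableSet.iUnion fun n => ?_
  exact (MeasurableSet.const _).inter (measurableSet_le measurable_const (hm n))

lemma measurable_visits (hθ : Measurable θ) {B : Set Ω} (hB : MeasurableSet B) (n : ℕ) :
    Measurable (visits θ B n) := by
  unfold visits birkhoffSum
  exact Finset.measurable_sum _ fun k _ =>
    (measurable_one.indicator hB).comp (hθ.iterate k)

lemma lintegral_visits (hθ : MeasurePreserving θ P P) {B : Set Ω} (hB : MeasurableSet B)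
    (n : ℕ) : ∫⁻ ω, visits θ B n ω ∂P = n * P B := by
  unfold visits birkhoffSum
  rw [lintegral_finsetSum (f := fun k ω => B.indicator (1 : Ω → ℝ≥0∞) (θ^[k] ω)) _ fun k _ =>
    (measurable_one.indicator hB).comp (hθ.measurable.iterate k)]
  have : ∀ k, ∫⁻ ω, B.indicator 1 (θ^[k] ω) ∂P = P B := fun k => by
    rw [(hθ.iterate k).lintegral_comp (measurable_one.indicator hB), lintegral_indicator_one hB]
  simp [this]

variable [IsProbabilityMeasure P]

lemma measure_excessSet_eq_zero_or (hθ : Ergodic θ P) (hg : IsSuperadditive θ g)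
    (hm : ∀ n, Measurable (g n)) (a : ℝ≥0) :
    P (excessSet g a) = 0 ∨ ∀ᵐ ω ∂P, ω ∈ excessSet g a := by
  rcases hθ.ae_empty_or_univ_of_preimage_ae_le
    (measurableSet_excessSet hm a).nullMeasurableSet
    (preimage_excessSet_subset hg a).eventuallyLE with h | h
  · exact Or.inl (ae_eq_empty.1 h)
  · exact Or.inr (eventuallyEq_univ.1 h)

/-- If the rate `a` is reached in finite time almost surely, then it is reached in bounded time
off a set of small measure. -/
lemma exists_bounded_time (hm : ∀ n, Measurable (g n)) {a : ℝ≥0∞}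
    (h : ∀ᵐ ω ∂P, ∃ n : ℕ, 1 ≤ n ∧ a * n ≤ g n ω) {ε : ℝ≥0∞} (hε : 0 < ε) :
    ∃ (M : ℕ) (B : Set Ω), MeasurableSet B ∧ P B < ε ∧
      ∀ ω ∉ B, ∃ n, 1 ≤ n ∧ n ≤ M ∧ a * n ≤ g n ω := by
  let B : ℕ → Set Ω := fun M => ⋂ n : ℕ, {ω | 1 ≤ n → n ≤ M → g n ω < a * n}
  have hBm : ∀ M, MeasurableSet (B M) := fun M => MeasurableSet.iInter fun n => by
    by_cases h1 : 1 ≤ n ∧ n ≤ M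
    · simpa [h1.1, h1.2] using measurableSet_lt (hm n) measurable_const
    · have : {ω | 1 ≤ n → n ≤ M → g n ω < a * n} = Set.univ := by
        ext ω; simp only [Set.mem_ofPred_eq, Set.mem_univ, iff_true]
        exact fun h2 h3 => absurd ⟨h2, h3⟩ h1
      rw [this]; exact MeasurableSet.univ
  have hanti : Antitone B := fun M M' hM ω hω => Set.mem_iInter.2 fun n h1 h2 =>
    Set.mem_iInter.1 hω n h1 (h2.trans hM)
  have hnull : P (⋂ M, B M) = 0 := by
    refine measure_mono_null (fun ω hω => ?_) (ae_iff.1 h)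
    rintro ⟨n, hn, h1⟩
    exact (Set.mem_iInter.1 (Set.mem_iInter.1 hω n) n hn le_rfl).not_ge h1
  have htend := tendsto_measure_iInter_atTop (μ := P)
    (fun M => (hBm M).nullMeasurableSet) hanti ⟨0, measure_ne_top P _⟩
  rw [hnull] at htend
  obtain ⟨M, hM⟩ := (htend.eventually (gt_mem_nhds hε)).exists
  refine ⟨M, B M, hBm M, hM, fun ω hω => ?_⟩
  simpa [B] using hω

/-- Almost surely, the frequency of visits to `B` is at most `P B`. -/
lemma ae_visits_lt (hθ : Ergodic θ P) {B : Set Ω} (hB : MeasurableSet B) {t : ℝ≥0}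
    (ht : P B < t) :
    ∀ᵐ ω ∂P, ∃ C : ℕ, ∀ n : ℕ, 1 ≤ n → visits θ B n ω < t * n + C := by
  have hvm := measurable_visits hθ.measurable hB
  rcases measure_excessSet_eq_zero_or hθ (isSuperadditive_visits B) hvm t with h | h
  · filter_upwards [measure_eq_zero_iff_ae_notMem.1 h] with ω hω
    simpa [excessSet] using hω
  -- Otherwise rate `t` is reached almost surely; integrating the greedy bound would give mean visit
  -- frequency above `P B`, contradicting invariance.
  exfalso
  have htop : P B ≠ ⊤ := measure_ne_top P B
  lift P B to ℝ≥0 using htop with p hp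
  have hpt : p < t := by exact_mod_cast ht
  have htpos : 0 < t := pos_of_gt hpt
  obtain ⟨e, he, het⟩ : ∃ e : ℝ≥0, 0 < e ∧ p + t * e < t := by
    refine ⟨(t - p) / (2 * t), by have := tsub_pos_of_lt hpt; positivity, ?_⟩
    rw [← NNReal.coe_lt_coe]
    push_cast [NNReal.coe_sub hpt.le]
    have h1 : (0 : ℝ) < t := by exact_mod_cast htpos
    have h2 : (p : ℝ) < t := by exact_mod_cast hpt
    field_simp
    linarith
  obtain ⟨M, B', hB'm, hB'e, hB'⟩ := exists_bounded_time (P := P) hvm (a := t)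
    (h.mono fun ω hω => by simpa using hω 0) (ε := e) (by exact_mod_cast he)
  have key : ∀ N : ℕ, (t : ℝ≥0∞) * N ≤ (p * N : ℝ≥0) + (t * M : ℝ≥0) + t * (e * N) := by
    intro N
    have := lintegral_mono (μ := P)
      (fun ω => mul_le_add_visits (isSuperadditive_visits B) hB' N ω)
    rw [lintegral_const, measure_univ, mul_one,
      lintegral_add_right _ ((measurable_visits hθ.measurable hB'm N).const_mul _),
      lintegral_add_right _ measurable_const, lintegral_const, measure_univ, mul_one,
      lintegral_const_mul _ (measurable_visits hθ.measurable hB'm N),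
      lintegral_visits hθ.toMeasurePreserving hB'm,
      lintegral_visits hθ.toMeasurePreserving hB, ← hp] at this
    refine this.trans ?_
    push_cast
    rw [mul_comm (p : ℝ≥0∞), mul_comm (e : ℝ≥0∞)]
    gcongr
  obtain ⟨N, hN, hN1⟩ := ((eventually_lt_div (b := p) key het).and
    (eventually_ge_atTop 1)).exists
  rw [ENNReal.coe_mul, ENNReal.coe_natCast, ENNReal.mul_div_cancel_right
    (by exact_mod_cast (by omega : N ≠ 0)) (ENNReal.natCast_ne_top N)] at hN
  exact lt_irrefl _ hN

/-- If the rate `a` is reached in bounded time off `B`, then the averages of `g` are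
eventually larger than every `b < a (1 - t)`, where `t` exceeds the measure of `B`. -/
lemma ae_eventually_lt_div (hθ : Ergodic θ P) (hg : IsSuperadditive θ g) {B : Set Ω}
    (hBm : MeasurableSet B) {a b t : ℝ≥0} {M : ℕ} (ht : P B < t) (hb : b + a * t < a)
    (hB : ∀ ω ∉ B, ∃ n, 1 ≤ n ∧ n ≤ M ∧ (a : ℝ≥0∞) * n ≤ g n ω) :
    ∀ᵐ ω ∂P, ∀ᶠ N : ℕ in atTop, (b : ℝ≥0∞) < g N ω / N := by
  filter_upwards [ae_visits_lt hθ hBm ht] with ω hω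
  obtain ⟨C, hC⟩ := hω
  refine eventually_lt_div (K := a * M + a * C) (t := t) (fun N => ?_) hb
  rcases Nat.eq_zero_or_pos N with rfl | hN
  · simp
  calc (a : ℝ≥0∞) * N ≤ g N ω + a * M + a * visits θ B N ω := mul_le_add_visits hg hB N ω
    _ ≤ g N ω + a * M + a * (t * N + C) := by gcongr; exact (hC N hN).le
    _ = _ := by push_cast; ring

/-- The subadditive ergodic theorem for nonnegative superadditive processes over an ergodic
transformation, with the positivity criterion for the limit. -/
theorem exists_tendsto_div (hθ : Ergodic θ P) (hg : IsSuperadditive θ g)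
    (hm : ∀ n, Measurable (g n)) :
    ∃ c : ℝ≥0∞, (∀ᵐ ω ∂P, Tendsto (fun n : ℕ => g n ω / n) atTop (𝓝 c)) ∧
      (0 < c ↔ ∃ L : ℕ, 1 ≤ L ∧ 0 < P {ω | 0 < g L ω}) := by
  let S : Set ℝ≥0∞ := {a | a ≠ ⊤ ∧ P (excessSet g a) ≠ 0}
  let c : ℝ≥0∞ := sSup S
  have hlow : ∀ b : ℝ≥0, (b : ℝ≥0∞) < c →
      ∀ᵐ ω ∂P, ∀ᶠ N : ℕ in atTop, (b : ℝ≥0∞) < g N ω / N := by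
    intro b hb
    obtain ⟨a, ⟨hatop, ha⟩, hba⟩ := lt_sSup_iff.1 hb
    lift a to ℝ≥0 using hatop
    have hba' : b < a := by exact_mod_cast hba
    have hapos : 0 < a := pos_of_gt hba'
    have hae := (measure_excessSet_eq_zero_or hθ hg hm a).resolve_left ha
    obtain ⟨t, ht, hbt⟩ : ∃ t : ℝ≥0, 0 < t ∧ b + a * t < a := by
      refine ⟨(a - b) / (2 * a), by have := tsub_pos_of_lt hba'; positivity, ?_⟩
      rw [← NNReal.coe_lt_coe]
      push_cast [NNReal.coe_sub hba'.le]
      have h1 : (0 : ℝ) < a := by exact_mod_cast hapos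
      have h2 : (b : ℝ) < a := by exact_mod_cast hba'
      field_simp
      linarith
    obtain ⟨M, B, hBm, hPB, hB⟩ := exists_bounded_time (P := P) hm (a := a)
      (hae.mono fun ω hω => by simpa using hω 0) (ε := t) (by exact_mod_cast ht)
    exact ae_eventually_lt_div hθ hg hBm hPB hbt hB
  have hupp : ∀ b : ℝ≥0, c < b → ∀ᵐ ω ∂P, ∀ᶠ N : ℕ in atTop, g N ω / N < b := by
    intro b hb
    obtain ⟨a, hca, hab⟩ := ENNReal.lt_iff_exists_nnreal_btwn.1 hb
    have h0 : P (excessSet g a) = 0 := by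
      by_contra h
      exact hca.not_ge (le_sSup (show (a : ℝ≥0∞) ∈ S from ⟨ENNReal.coe_ne_top, h⟩))
    filter_upwards [measure_eq_zero_iff_ae_notMem.1 h0] with ω hω
    obtain ⟨C, hC⟩ : ∃ C : ℕ, ∀ n : ℕ, 1 ≤ n → g n ω < a * n + C := by
      simpa [excessSet] using hω
    exact eventually_div_lt hC (by exact_mod_cast hab)
  have hlim : ∀ᵐ ω ∂P, Tendsto (fun n : ℕ => g n ω / n) atTop (𝓝 c) := by
    -- Rational thresholds allow one null set for all of them.
    have h1 : ∀ᵐ ω ∂P, ∀ q : ℚ, ((Real.toNNReal q : ℝ≥0) : ℝ≥0∞) < c →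
        ∀ᶠ N : ℕ in atTop, ((Real.toNNReal q : ℝ≥0) : ℝ≥0∞) < g N ω / N :=
      ae_all_iff.2 fun q => eventually_imp_distrib_left.2 fun h => hlow _ h
    have h2 : ∀ᵐ ω ∂P, ∀ q : ℚ, c < ((Real.toNNReal q : ℝ≥0) : ℝ≥0∞) →
        ∀ᶠ N : ℕ in atTop, g N ω / N < ((Real.toNNReal q : ℝ≥0) : ℝ≥0∞) :=
      ae_all_iff.2 fun q => eventually_imp_distrib_left.2 fun h => hupp _ h
    filter_upwards [h1, h2] with ω h1 h2
    refine tendsto_order.2 ⟨fun b hb => ?_, fun b hb => ?_⟩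
    · obtain ⟨q, -, hq1, hq2⟩ := ENNReal.lt_iff_exists_rat_btwn.1 hb
      exact (h1 q hq2).mono fun N hN => hq1.trans hN
    · obtain ⟨q, -, hq1, hq2⟩ := ENNReal.lt_iff_exists_rat_btwn.1 hb
      exact (h2 q hq1).mono fun N hN => hN.trans hq2
  refine ⟨c, hlim, ?_, ?_⟩
  · intro hc
    by_contra! hall
    have hae : ∀ᵐ ω ∂P, ∀ L : ℕ, 1 ≤ L → g L ω = 0 := by
      refine ae_all_iff.2 fun L => eventually_imp_distrib_left.2 fun hL => ?_
      rw [ae_iff]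
      simpa [pos_iff_ne_zero] using hall L hL
    obtain ⟨ω, hω1, hω2⟩ := (hlim.and hae).exists
    refine hc.ne' (tendsto_nhds_unique hω1 (tendsto_const_nhds.congr' ?_))
    filter_upwards [eventually_ge_atTop 1] with n hn
    simp [hω2 n hn]
  · rintro ⟨L, hL, hpos⟩
    obtain ⟨δ, hδ, hPδ⟩ : ∃ δ : ℝ≥0, 0 < δ ∧ 0 < P {ω | (δ : ℝ≥0∞) ≤ g L ω} := by
      by_contra! hall
      have : P (⋃ k : ℕ, {ω | (((k : ℝ≥0) + 1)⁻¹ : ℝ≥0) ≤ g L ω}) = 0 :=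
        measure_iUnion_null fun k => le_antisymm (hall _ (by positivity)) bot_le
      refine hpos.ne' (measure_mono_null (fun ω hω => ?_) this)
      obtain ⟨r, hr0, hr⟩ := ENNReal.lt_iff_exists_nnreal_btwn.1 (show 0 < g L ω from hω)
      obtain ⟨k, hk⟩ := exists_nat_one_div_lt (show (0 : ℝ≥0) < r by exact_mod_cast hr0)
      refine Set.mem_iUnion.2 ⟨k, ?_⟩
      refine le_trans ?_ hr.le
      rw [one_div] at hk
      exact_mod_cast hk.le
    have hDm : MeasurableSet {ω | (δ : ℝ≥0∞) ≤ g L ω} := measurableSet_le measurable_const (hm L)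
    have hlt : P {ω | (δ : ℝ≥0∞) ≤ g L ω}ᶜ < 1 := by
      rw [prob_compl_eq_one_sub hDm]
      exact ENNReal.sub_lt_self ENNReal.one_ne_top one_ne_zero hPδ.ne'
    obtain ⟨t, ht, ht1⟩ := ENNReal.lt_iff_exists_nnreal_btwn.1 hlt
    have ht1' : t < 1 := by exact_mod_cast ht1
    have hL0 : (0 : ℝ≥0) < L := by exact_mod_cast hL
    -- Half of the rate `δ / L * (1 - t)` that survives the visits to the complement.
    obtain ⟨b, hb0, hb⟩ : ∃ b : ℝ≥0, 0 < b ∧ b + δ / L * t < δ / L := by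
      have ha : 0 < δ / (L : ℝ≥0) := by positivity
      refine ⟨δ / L * (1 - t) / 2, by have := tsub_pos_of_lt ht1'; positivity, ?_⟩
      rw [← NNReal.coe_lt_coe] at ha ⊢
      have h2 : (t : ℝ) < 1 := by exact_mod_cast ht1'
      push_cast [NNReal.coe_sub ht1'.le] at ha ⊢
      nlinarith
    have hB : ∀ ω ∉ {ω | (δ : ℝ≥0∞) ≤ g L ω}ᶜ, ∃ n, 1 ≤ n ∧ n ≤ L ∧
        ((δ / L : ℝ≥0) : ℝ≥0∞) * n ≤ g n ω := by
      intro ω hω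
      refine ⟨L, hL, le_rfl, ?_⟩
      have : ((δ / L : ℝ≥0) : ℝ≥0∞) * L = δ := by
        have h : (δ / L : ℝ≥0) * L = δ := div_mul_cancel₀ _ hL0.ne'
        exact_mod_cast congrArg ((↑) : ℝ≥0 → ℝ≥0∞) h
      rw [this]
      simpa using hω
    obtain ⟨ω, hω1, hω2⟩ :=
      (hlim.and (ae_eventually_lt_div hθ hg hDm.compl ht hb hB)).exists
    exact lt_of_lt_of_le (by exact_mod_cast hb0)
      (ge_of_tendsto hω1 (hω2.mono fun N hN => hN.le))

end Measure

end SuperadditiveProcess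

namespace TraceDobrushin

open Matrix

variable {d : ℕ}

/-! ### Trace norm and positive trace-preserving maps -/

section TraceNorm

open scoped ComplexOrder

lemma traceNorm_nonneg (X : Mat d) : 0 ≤ traceNorm X :=
  Finset.sum_nonneg fun _ _ => Real.sqrt_nonneg _

/-- The trace norm of a unitarily diagonalized Hermitian matrix. -/
lemma traceNorm_conj_diagonal (U : Mat d) (hU : U ∈ unitaryGroup (Fin d) ℂ) (v : Fin d → ℝ) :
    traceNorm (U * diagonal (fun i => (v i : ℂ)) * star U) = ∑ i, |v i| := by
  set X : Mat d := U * diagonal (fun i => (v i : ℂ)) * star U with hX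
  have hUU : star U * U = 1 := mem_unitaryGroup_iff'.1 hU
  have hXX : Xᴴ * X = U * diagonal (fun i => ((v i ^ 2 : ℝ) : ℂ)) * star U := by
    have h1 : Xᴴ = X := by
      simp only [hX, ← star_eq_conjTranspose, star_mul, star_star, mul_assoc]
      congr 2
      rw [star_eq_conjTranspose, diagonal_conjTranspose]
      congr 1
      ext i
      simp
    rw [h1, hX]
    calc U * diagonal (fun i => (v i : ℂ)) * star U * (U * diagonal (fun i => (v i : ℂ)) * star U)
        = U * diagonal (fun i => (v i : ℂ)) * (star U * U) * diagonal (fun i => (v i : ℂ))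
          * star U := by simp only [mul_assoc]
      _ = U * (diagonal (fun i => (v i : ℂ)) * diagonal (fun i => (v i : ℂ))) * star U := by
          rw [hUU, mul_one]; simp only [mul_assoc]
      _ = _ := by
          rw [diagonal_mul_diagonal]
          congr 3
          ext i
          push_cast
          ring
  -- Multisets of characteristic roots avoid matching the ordering of the eigenvalues.
  have hroots : (Xᴴ * X).charpoly.roots
      = Finset.univ.val.map (fun i => ((v i ^ 2 : ℝ) : ℂ)) := by
    rw [hXX, charpoly_mul_comm, ← mul_assoc, hUU, one_mul, charpoly_diagonal,
      Polynomial.roots_prod _ _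
        (Finset.prod_ne_zero_iff.2 fun i _ => Polynomial.X_sub_C_ne_zero _)]
    simp only [Polynomial.roots_X_sub_C, Multiset.bind_singleton]
  have heig := (isHermitian_conjTranspose_mul_self X).roots_charpoly_eq_eigenvalues
  rw [hroots] at heig
  have := congrArg (fun s : Multiset ℂ => (s.map fun z => √z.re).sum) heig
  simp only [Multiset.map_map, Function.comp_def, Complex.ofReal_re, Real.sqrt_sq_eq_abs,
    RCLike.ofReal_eq_complex_ofReal] at this
  exact this.symm

/-- The sum of the moduli of the diagonal entries of `X` in the basis given by `U`. -/
noncomputable def diagNorm (U X : Mat d) : ℝ := ∑ i, ‖(star U * X * U) i i‖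

lemma exists_diagonalization {X : Mat d} (hX : X.IsHermitian) :
    ∃ U ∈ unitaryGroup (Fin d) ℂ, ∃ v : Fin d → ℝ,
      X = U * diagonal (fun i => (v i : ℂ)) * star U ∧ traceNorm X = ∑ i, |v i| := by
  refine ⟨hX.eigenvectorUnitary, hX.eigenvectorUnitary.2, hX.eigenvalues, ?_, ?_⟩
  · exact hX.spectral_theorem
  · rw [← traceNorm_conj_diagonal _ hX.eigenvectorUnitary.2]
    exact congrArg traceNorm hX.spectral_theorem

lemma exists_traceNorm_eq_diagNorm {X : Mat d} (hX : X.IsHermitian) :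
    ∃ U ∈ unitaryGroup (Fin d) ℂ, traceNorm X = diagNorm U X := by
  obtain ⟨U, hU, v, h, hn⟩ := exists_diagonalization hX
  refine ⟨U, hU, ?_⟩
  have hUU : star U * U = 1 := mem_unitaryGroup_iff'.1 hU
  have : star U * X * U = diagonal (fun i => (v i : ℂ)) := by
    calc star U * X * U
        = (star U * U) * diagonal (fun i => (v i : ℂ)) * (star U * U) := by
          rw [h]; simp only [mul_assoc]
      _ = _ := by rw [hUU, one_mul, mul_one]
  simp [diagNorm, this, hn]

/-- Jordan decomposition into positive and negative spectral parts. -/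
lemma exists_posSemidef_sub {X : Mat d} (hX : X.IsHermitian) :
    ∃ A B : Mat d, A.PosSemidef ∧ B.PosSemidef ∧ X = A - B ∧
      traceNorm X = A.trace.re + B.trace.re := by
  obtain ⟨U, hU, v, h, hn⟩ := exists_diagonalization hX
  have hUU : star U * U = 1 := mem_unitaryGroup_iff'.1 hU
  have hpsd : ∀ w : Fin d → ℝ, (∀ i, 0 ≤ w i) →
      (U * diagonal (fun i => (w i : ℂ)) * star U).PosSemidef := fun w hw =>
    (posSemidef_diagonal_iff.2 fun i => by exact_mod_cast hw i).mul_mul_conjTranspose_same U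
  have htr : ∀ w : Fin d → ℝ,
      (U * diagonal (fun i => (w i : ℂ)) * star U).trace.re = ∑ i, w i := fun w => by
    rw [trace_mul_comm, ← mul_assoc, hUU, one_mul, trace_diagonal]
    simp
  refine ⟨_, _, hpsd (fun i => max (v i) 0) fun i => le_max_right _ _,
    hpsd (fun i => max (-v i) 0) fun i => le_max_right _ _, ?_, ?_⟩
  · rw [h, ← sub_mul, ← mul_sub, diagonal_sub]
    congr 3
    ext i
    rw [← Complex.ofReal_sub, max_zero_sub_max_neg_zero_eq_self]
  · rw [htr, htr, hn, ← Finset.sum_add_distrib]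
    refine Finset.sum_congr rfl fun i _ => ?_
    rw [max_zero_add_max_neg_zero_eq_abs_self]

lemma diagNorm_of_posSemidef {U A : Mat d} (hU : U ∈ unitaryGroup (Fin d) ℂ)
    (hA : A.PosSemidef) : diagNorm U A = A.trace.re := by
  have hUU : U * star U = 1 := mem_unitaryGroup_iff.1 hU
  have h1 : ∀ i, ‖(star U * A * U) i i‖ = ((star U * A * U) i i).re := fun i =>
    Complex.norm_of_nonneg' (hA.conjTranspose_mul_mul_same U).diag_nonneg |> fun h => by
      exact_mod_cast congrArg Complex.re h
  have h2 : (star U * A * U).trace = A.trace := by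
    rw [trace_mul_comm, ← mul_assoc, hUU, one_mul]
  rw [← h2, diagNorm, trace, Complex.re_sum]
  exact Finset.sum_congr rfl fun i _ => h1 i

lemma diagNorm_sub_le (U A B : Mat d) : diagNorm U (A - B) ≤ diagNorm U A + diagNorm U B := by
  rw [diagNorm, diagNorm, diagNorm, ← Finset.sum_add_distrib]
  refine Finset.sum_le_sum fun i _ => ?_
  rw [mul_sub, sub_mul, Matrix.sub_apply]
  exact norm_sub_le _ _

/-- Pinching inequality. With `exists_traceNorm_eq_diagNorm` it makes the trace norm of a Hermitian
matrix a maximum over unitary bases. -/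
lemma diagNorm_le_traceNorm {U X : Mat d} (hU : U ∈ unitaryGroup (Fin d) ℂ)
    (hX : X.IsHermitian) : diagNorm U X ≤ traceNorm X := by
  obtain ⟨A, B, hA, hB, rfl, hn⟩ := exists_posSemidef_sub hX
  rw [hn, ← diagNorm_of_posSemidef hU hA, ← diagNorm_of_posSemidef hU hB]
  exact diagNorm_sub_le U A B

lemma traceNorm_sub_le {A B : Mat d} (hA : A.PosSemidef) (hB : B.PosSemidef) :
    traceNorm (A - B) ≤ A.trace.re + B.trace.re := by
  obtain ⟨U, hU, h⟩ := exists_traceNorm_eq_diagNorm (hA.1.sub hB.1)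
  rw [h, ← diagNorm_of_posSemidef hU hA, ← diagNorm_of_posSemidef hU hB]
  exact diagNorm_sub_le U A B

lemma traceNorm_zero : traceNorm (0 : Mat d) = 0 :=
  le_antisymm (by simpa using traceNorm_sub_le (d := d) PosSemidef.zero PosSemidef.zero)
    (traceNorm_nonneg _)

lemma traceNorm_pos {X : Mat d} (hX : X.IsHermitian) (h0 : X ≠ 0) : 0 < traceNorm X := by
  obtain ⟨U, -, v, h, hn⟩ := exists_diagonalization hX
  refine (traceNorm_nonneg X).lt_of_ne' fun hz => h0 ?_
  rw [hn, Finset.sum_eq_zero_iff_of_nonneg fun i _ => abs_nonneg _] at hz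
  have : (fun i => (v i : ℂ)) = fun _ => 0 := by
    ext i
    simpa using hz i (Finset.mem_univ i)
  rw [h, this]
  simp

/-- Positive trace-preserving maps. -/
def IsPTP (T : Mat d →ₗ[ℂ] Mat d) : Prop :=
  (∀ X : Mat d, X.PosSemidef → (T X).PosSemidef) ∧ ∀ X : Mat d, (T X).trace = X.trace

lemma isPTP_id : IsPTP (LinearMap.id : Mat d →ₗ[ℂ] Mat d) := ⟨fun _ h => h, fun _ => rfl⟩

lemma IsPTP.comp {S T : Mat d →ₗ[ℂ] Mat d} (hS : IsPTP S) (hT : IsPTP T) : IsPTP (S ∘ₗ T) :=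
  ⟨fun X h => hS.1 _ (hT.1 X h), fun X => (hS.2 _).trans (hT.2 X)⟩

lemma IsPTP.isHermitian {T : Mat d →ₗ[ℂ] Mat d} (hT : IsPTP T) {X : Mat d}
    (hX : X.IsHermitian) : (T X).IsHermitian := by
  obtain ⟨A, B, hA, hB, rfl, -⟩ := exists_posSemidef_sub hX
  rw [map_sub]
  exact (hT.1 A hA).1.sub (hT.1 B hB).1

lemma IsPTP.traceNorm_le {T : Mat d →ₗ[ℂ] Mat d} (hT : IsPTP T) {X : Mat d}
    (hX : X.IsHermitian) : traceNorm (T X) ≤ traceNorm X := by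
  obtain ⟨A, B, hA, hB, rfl, hn⟩ := exists_posSemidef_sub hX
  rw [hn, map_sub, ← hT.2 A, ← hT.2 B]
  exact traceNorm_sub_le (hT.1 A hA) (hT.1 B hB)

end TraceNorm

section CompletePositivity

open scoped CStarAlgebra ComplexOrder MatrixOrder Matrix.Norms.L2Operator

lemma IsCPTP.isPTP {T : Mat d →ₗ[ℂ] Mat d} (hT : IsCPTP T) : IsPTP T := by
  obtain ⟨⟨φ, rfl⟩, htr⟩ := hT
  exact ⟨fun X hX => nonneg_iff_posSemidef.1 (map_nonneg φ hX.nonneg), htr⟩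

end CompletePositivity

/-! ### Submultiplicativity and measurability of the coefficient -/

lemma kappaTr_le_one {T : Mat d →ₗ[ℂ] Mat d} (hT : IsPTP T) : kappaTr T ≤ 1 :=
  iSup₂_le fun X hX => ENNReal.ofReal_le_one.2
    (div_le_one_of_le₀ (hT.traceNorm_le hX.1) (traceNorm_nonneg X))

lemma kappaTr_comp_le {S T : Mat d →ₗ[ℂ] Mat d} (hT : IsPTP T) :
    kappaTr (S ∘ₗ T) ≤ kappaTr S * kappaTr T := by
  refine iSup₂_le fun X hX => ?_
  have hT' : ENNReal.ofReal (traceNorm (T X) / traceNorm X) ≤ kappaTr T :=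
    le_iSup₂ (f := fun X _ => ENNReal.ofReal (traceNorm (T X) / traceNorm X)) X hX
  by_cases h0 : T X = 0
  · simp [h0, traceNorm_zero]
  have hS' : ENNReal.ofReal (traceNorm (S (T X)) / traceNorm (T X)) ≤ kappaTr S :=
    le_iSup₂ (f := fun X _ => ENNReal.ofReal (traceNorm (S X) / traceNorm X)) (T X)
      ⟨hT.isHermitian hX.1, (hT.2 X).trans hX.2.1, h0⟩
  refine le_trans (le_of_eq ?_) (mul_le_mul' hS' hT')
  rw [← ENNReal.ofReal_mul (div_nonneg (traceNorm_nonneg _) (traceNorm_nonneg _)),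
    div_mul_div_cancel₀ (traceNorm_pos (hT.isHermitian hX.1) h0).ne', LinearMap.comp_apply]

lemma ofReal_traceNorm_div {X : Mat d} (hX : X.IsHermitian) {c : ℝ} (hc : 0 ≤ c) :
    ENNReal.ofReal (traceNorm X / c)
      = ⨆ U ∈ unitaryGroup (Fin d) ℂ, ENNReal.ofReal (diagNorm U X / c) := by
  refine le_antisymm ?_ (iSup₂_le fun U hU => ?_)
  · obtain ⟨U, hU, h⟩ := exists_traceNorm_eq_diagNorm hX
    rw [h]
    exact le_iSup₂ (f := fun U _ => ENNReal.ofReal (diagNorm U X / c)) U hU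
  · exact ENNReal.ofReal_le_ofReal
      (div_le_div_of_nonneg_right (diagNorm_le_traceNorm hU hX) hc)

/-- Matrix entries of the image of `X` in terms of the images of the matrix units. -/
lemma map_eq_sum_single (T : Mat d →ₗ[ℂ] Mat d) (X : Mat d) :
    T X = Matrix.of fun k l => ∑ i, ∑ j, X i j * T (single i j 1) k l := by
  have h : X = ∑ i, ∑ j, X i j • single i j (1 : ℂ) := by
    simpa [smul_single] using matrix_eq_sum_single X
  ext k l
  conv_lhs => rw [h]
  simp only [map_sum, map_smul, Matrix.sum_apply, Matrix.smul_apply, smul_eq_mul, of_apply]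

/-- The supremum is uncountable, but each term is continuous in the entries of `T` on matrix units,
so the coefficient is lower semicontinuous in them. -/
lemma measurable_kappaTr {Ω : Type*} [MeasurableSpace Ω] {T : Ω → Mat d →ₗ[ℂ] Mat d}
    (hm : ∀ (X : Mat d) (i j : Fin d), Measurable fun ω => T ω X i j) (hT : ∀ ω, IsPTP (T ω)) :
    Measurable fun ω => kappaTr (T ω) := by
  let F : (Fin d × Fin d × Fin d × Fin d → ℂ) → ℝ≥0∞ := fun f =>
    ⨆ X ∈ {X : Mat d | X.IsHermitian ∧ X.trace = 0 ∧ X ≠ 0}, ⨆ U ∈ unitaryGroup (Fin d) ℂ,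
      ENNReal.ofReal
        (diagNorm U (Matrix.of fun k l => ∑ i, ∑ j, X i j * f (i, j, k, l)) / traceNorm X)
  have hF : LowerSemicontinuous F := by
    refine lowerSemicontinuous_biSup fun X _ => lowerSemicontinuous_biSup fun U _ => ?_
    refine Continuous.lowerSemicontinuous (ENNReal.continuous_ofReal.comp ?_)
    simp only [diagNorm, Matrix.mul_apply, Matrix.of_apply]
    fun_prop
  have hcomp : (fun ω => kappaTr (T ω)) = F ∘ fun ω p => T ω (single p.1 p.2.1 1) p.2.2.1 p.2.2.2 := by
    ext ω
    refine iSup_congr fun X => iSup_congr fun hX => ?_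
    rw [ofReal_traceNorm_div ((hT ω).isHermitian hX.1) (traceNorm_nonneg X)]
    simp only [map_eq_sum_single (T ω) X]
  rw [hcomp]
  refine hF.measurable.comp ?_
  exact measurable_pi_lambda _ fun p => hm _ _ _

/-! ### The cocycle and its logarithmic coefficient -/

section ForwardProduct

variable {Ω : Type*} {θ : Ω → Ω} {Φ : Ω → Mat d →ₗ[ℂ] Mat d}

lemma forwardProduct_add (m n : ℕ) (ω : Ω) :
    forwardProduct θ Φ (m + n) ω
      = forwardProduct θ Φ n (θ^[m] ω) ∘ₗ forwardProduct θ Φ m ω := by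
  induction n with
  | zero => rfl
  | succ n ih =>
    rw [← add_assoc, forwardProduct, ih, forwardProduct, LinearMap.comp_assoc, add_comm m n,
      Function.iterate_add_apply]

lemma isPTP_forwardProduct (hΦ : ∀ ω, IsPTP (Φ ω)) (n : ℕ) (ω : Ω) :
    IsPTP (forwardProduct θ Φ n ω) := by
  induction n with
  | zero => exact isPTP_id
  | succ n ih => exact (hΦ _).comp ih

lemma measurable_forwardProduct [MeasurableSpace Ω] (hθ : Measurable θ)
    (hm : ∀ (X : Mat d) (i j : Fin d), Measurable fun ω => Φ ω X i j) (n : ℕ) (X : Mat d)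
    (i j : Fin d) : Measurable fun ω => forwardProduct θ Φ n ω X i j := by
  induction n generalizing i j with
  | zero => exact measurable_const
  | succ n ih =>
    have : (fun ω => forwardProduct θ Φ (n + 1) ω X i j) = fun ω =>
        ∑ k, ∑ l, forwardProduct θ Φ n ω X k l * Φ (θ^[n] ω) (single k l 1) i j := by
      ext ω
      rw [forwardProduct, LinearMap.comp_apply, map_eq_sum_single, Matrix.of_apply]
    rw [this]
    exact Finset.measurable_sum _ fun k _ => Finset.measurable_sum _ fun l _ =>
      (ih k l).mul ((hm _ i j).comp (hθ.iterate n))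

lemma logKappa_nonpos (hΦ : ∀ ω, IsPTP (Φ ω)) (n : ℕ) (ω : Ω) : logKappa θ Φ n ω ≤ 0 :=
  ENNReal.log_le_zero_iff.2 (kappaTr_le_one (isPTP_forwardProduct hΦ n ω))

lemma logKappa_add_le (hΦ : ∀ ω, IsPTP (Φ ω)) (m n : ℕ) (ω : Ω) :
    logKappa θ Φ (m + n) ω ≤ logKappa θ Φ m ω + logKappa θ Φ n (θ^[m] ω) := by
  rw [logKappa, logKappa, logKappa, ← ENNReal.log_mul_add, mul_comm, blockKappa,
    forwardProduct_add]
  exact ENNReal.log_monotone (kappaTr_comp_le (isPTP_forwardProduct hΦ m ω))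

lemma isSuperadditive_neg_logKappa (hΦ : ∀ ω, IsPTP (Φ ω)) :
    SuperadditiveProcess.IsSuperadditive θ fun n ω => (-logKappa θ Φ n ω).toENNReal := by
  intro m n ω
  have h1 := logKappa_nonpos (θ := θ) hΦ m ω
  have h2 := logKappa_nonpos (θ := θ) hΦ n (θ^[m] ω)
  have h3 := logKappa_add_le (θ := θ) hΦ m n ω
  beta_reduce
  generalize logKappa θ Φ m ω = x at *
  generalize logKappa θ Φ n (θ^[m] ω) = y at *
  rw [← EReal.toENNReal_add (EReal.neg_nonneg.2 h1) (EReal.neg_nonneg.2 h2)]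
  refine EReal.toENNReal_le_toENNReal ?_
  rwa [← sub_eq_add_neg, ← EReal.neg_add (Or.inr (h2.trans_lt EReal.zero_lt_top).ne)
    (Or.inl (h1.trans_lt EReal.zero_lt_top).ne), EReal.neg_le_neg_iff]

/-- At `n = 0` this fails for `d = 1`: there `-log κ = ∞`, and `∞ / 0` is `∞` in `ℝ≥0∞` while
division by 0 in `EReal` gives 0. -/
lemma logKappa_div (hΦ : ∀ ω, IsPTP (Φ ω)) {n : ℕ} (hn : 1 ≤ n) (ω : Ω) :
    logKappa θ Φ n ω / (n : EReal)
      = -(((-logKappa θ Φ n ω).toENNReal / n : ℝ≥0∞) : EReal) := by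
  have hn' : (n : NNReal) ≠ 0 := by exact_mod_cast (by omega : n ≠ 0)
  have hinv : (((n : ℝ≥0∞)⁻¹ : ℝ≥0∞) : EReal) = (n : EReal)⁻¹ := by
    rw [← ENNReal.coe_natCast, ← ENNReal.coe_inv hn']
    rfl
  rw [ENNReal.div_eq_inv_mul, EReal.coe_ennreal_mul, hinv,
    EReal.coe_toENNReal (EReal.neg_nonneg.2 (logKappa_nonpos hΦ n ω)), mul_neg, neg_neg,
    EReal.div_eq_inv_mul]

end ForwardProduct

end TraceDobrushin

/-- `(Ω, P, θ)` is an invertible ergodic probability-preserving system and `Φ` is a measurable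
family of quantum channels on `𝕄_d`; measurability into the finite-dimensional space of linear
maps on `𝕄_d` is measurability of all matrix entries of all `Φ_ω(X)`. -/
theorem mainTheorem11 {d : ℕ} {Ω : Type*} [MeasurableSpace Ω]
    (P : Measure Ω) [IsProbabilityMeasure P]
    (θ : Ω ≃ᵐ Ω) (hθ : Ergodic θ P)
    (Φ : Ω → Mat d →ₗ[ℂ] Mat d)
    (hΦmeas : ∀ (X : Mat d) (i j : Fin d), Measurable fun ω => Φ ω X i j)
    (hΦ : ∀ ω, IsCPTP (Φ ω)) :
    ∃ l : EReal, l ≤ 0 ∧ IsLyapunovExponent P θ Φ l ∧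
      (l < 0 ↔ ∃ L : ℕ, 1 ≤ L ∧ 0 < P {ω | blockKappa θ Φ L ω < 1}) ∧
      (l < 0 ↔ ∃ L : ℕ, 1 ≤ L ∧ nonposExpectation P (logKappa θ Φ L) < 0) := by
  have hΦ' : ∀ ω, IsPTP (Φ ω) := fun ω => (hΦ ω).isPTP
  have hm : ∀ n, Measurable fun ω => (-logKappa θ Φ n ω).toENNReal := fun n =>
    (ENNReal.measurable_log.comp (measurable_kappaTr
      (measurable_forwardProduct θ.measurable hΦmeas n)
      (isPTP_forwardProduct hΦ' n))).neg.ereal_toENNReal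
  obtain ⟨c, hlim, hc⟩ := SuperadditiveProcess.exists_tendsto_div hθ
    (isSuperadditive_neg_logKappa hΦ') hm
  have hneg : ∀ x : ℝ≥0∞, -(x : EReal) < 0 ↔ 0 < x := fun x => by
    rw [EReal.neg_lt_comm, neg_zero, EReal.coe_ennreal_pos]
  have hset : ∀ L, {ω | 0 < (-logKappa θ Φ L ω).toENNReal} = {ω | blockKappa θ Φ L ω < 1} :=
    fun L => by
      ext ω
      simp only [Set.mem_ofPred_eq, EReal.toENNReal_pos_iff]
      rw [EReal.lt_neg_comm, neg_zero, logKappa, ENNReal.log_lt_zero_iff]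
  refine ⟨-(c : EReal), ?_, ?_, ?_, ?_⟩
  · rw [EReal.neg_le, neg_zero]
    exact EReal.coe_ennreal_nonneg c
  · filter_upwards [hlim] with ω hω
    refine Tendsto.congr' ?_
      ((continuous_neg.comp continuous_coe_ennreal_ereal).continuousAt.tendsto.comp hω)
    filter_upwards [eventually_ge_atTop 1] with n hn
    exact (logKappa_div hΦ' hn ω).symm
  · rw [hneg, hc]
    simp only [hset]
  · rw [hneg, hc]
    -- The criteria agree for each `L`: a nonnegative function has positive integral exactly when
    -- its support has positive measure.
    refine exists_congr fun L => and_congr_right fun _ => ?_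
    rw [nonposExpectation, hneg, lintegral_pos_iff_support (hm L)]
    simp only [Function.support, pos_iff_ne_zero]
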